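/- Let $A$ be a finite alphabet with $|A|\ge 2$, let $e\notin A$ be an empty letter and $\bar A=A\cup\{e\}$. A string is a sequence $s=(x_j)_{j\ge 1}$ in $\bar A$ such that $x_h=e$ for some $h$, and $x_j=e$ implies $x_{j+1}=e$; let $A^*$ be the set of strings and $o=(e,e,\dots)$. The extended Hamming distance $d_{H'}(s,t)$ is the minimum number of substitutions of single letters of $\bar A$ that transform $s$ into $t$ (deleting the last letter, or appending a letter at the end, is a substitution into, or of, the letter $e$). For $\lambda\in A^*$, $\rho\in(0,\infty)$ the Laplace-like distribution $\mathrm{LA}(\lambda,\rho)$ has the probability function $$q(s;\lambda,\rho)=\frac{1}{(\rho+1)\,|\partial U(\lambda,d_{H'}(s,\lambda))|}\Bigl(\frac{\rho}{\rho+1}\Bigr)^{d_{H'}(s,\lambda)},\qquad \partial U(\lambda,r)=\{t\in A^*:d_{H'}(\lambda,t)=r\}.$$ Given $s_1,\dots,s_n\in A^*$, $n\ge1$, let $f_j(x)$ be the relative frequency of $x\in\bar A$ at site $j$ of $s_1,\dots,s_n$, put $j^*=\min\{j\ge 1: f_j(e)=\max_{x\in\bar A}f_j(x)\}-1$, and let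 $\eta(j)\in\bar A$ be any maximizer of $f_j$. For $\epsilon>0$ let $J_\epsilon$ be the set of $j\in\{1,\dots,j^*\}$ such that $\max_{a\in A}f_{j'}(a)-\min_{a\in A}f_{j'}(a)<\epsilon$ for all $j'\in\{j,\dots,j^*\}$. Let $k=\min J_\epsilon-1$ if $J_\epsilon\ne\emptyset$ and $k=j^*$ otherwise. The truncated consensus sequence is $m_c^{(\epsilon)}(s_1,\dots,s_n)=(\eta(1),\dots,\eta(k),e,e,\dots)\in A^*$ (equal to $o$ if $k=0$). A maximum likelihood estimate is a maximizer $(\check\lambda,\check\rho)$ of $\prod_{i=1}^n q(s_i;\lambda',\rho')$ over $(\lambda',\rho')\in A^*\times(0,\infty)$. Theorem. Let $\lambda\in A^*$ and $\rho>0$, and let $\sigma_1,\sigma_2,\dots$ be independent random strings, each distributed according to $\mathrm{LA}(\lambda,\rho)$. Then there is $\epsilon_0>0$ such that, almost surely, for every $0<\epsilon\le\epsilon_0$ there is $N_0\ge1$ (which may depend on the realization and on $\epsilon$) such that for all $n\ge N_0$ and the observations $s_i=\sigma_i(\omega)$, $1\le i\le n$, and for every choice of the maximizers $\eta(j)$,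 the maximum likelihood estimate exists, is unique, and is given by $$\check\lambda(s_1,\dots,s_n)=m_c^{(\epsilon)}(s_1,\dots,s_n),\qquad \check\rho(s_1,\dots,s_n)=\frac1n\sum_{i=1}^n d_{H'}\bigl(s_i,m_c^{(\epsilon)}(s_1,\dots,s_n)\bigr).$$ -/

import Mathlib

open MeasureTheory ProbabilityTheory

/-- A string on the alphabet `A`: a sequence of letters of the extended alphabet
`Option A` (`none` is the empty letter) which is eventually empty and stays empty after
its first empty letter. Sites are numbered from `0`. -/
@[ext]
structure AString (A : Type*) where
  letter : ℕ → Option A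
  exists_empty : ∃ h, letter h = none
  empty_succ : ∀ j, letter j = none → letter (j + 1) = none

namespace AString

variable {A : Type*}

/-- Events are arbitrary sets of strings. -/
instance : MeasurableSpace (AString A) := ⊤

lemma empty_of_le (s : AString A) {i j : ℕ} (hij : i ≤ j) (h : s.letter i = none) :
    s.letter j = none := by
  induction hij with
  | refl => exact h
  | step _ ih => exact s.empty_succ _ ih

/-- Two strings are adjacent if one is obtained from the other by the substitution of exactly
one letter of the extended alphabet (so deleting the last letter and appending a letter at the
end are substitutions into and of the empty letter). -/
def substGraph (A : Type*) : SimpleGraph (AString A) where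
  Adj s t := ∃ j, s.letter j ≠ t.letter j ∧ ∀ i, i ≠ j → s.letter i = t.letter i
  symm := ⟨fun _ _ ⟨j, h, h'⟩ => ⟨j, h.symm, fun i hi => (h' i hi).symm⟩⟩
  loopless := ⟨fun _ ⟨_, h, _⟩ => h rfl⟩

/-- The extended Hamming distance: the minimum number of substitutions that transform one
string into the other. -/
noncomputable def extHamming (s t : AString A) : ℕ := (substGraph A).dist s t

lemma finite_diff (s t : AString A) : {j | s.letter j ≠ t.letter j}.Finite := by
  obtain ⟨h, hs⟩ := s.exists_empty
  obtain ⟨k, ht⟩ := t.exists_empty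
  refine (Set.finite_lt_nat (max h k)).subset fun j hj => ?_
  by_contra hlt
  simp only [Set.mem_ofPred_eq, not_lt, sup_le_iff] at hlt
  exact hj ((s.empty_of_le hlt.1 hs).trans (t.empty_of_le hlt.2 ht).symm)

lemma ncard_diff_le_length {s t : AString A} (w : (substGraph A).Walk s t) :
    {j | s.letter j ≠ t.letter j}.ncard ≤ w.length := by
  induction w with
  | nil => simp
  | @cons s u t h w ih =>
    obtain ⟨j, -, hj⟩ := id h
    have hsub : {i | s.letter i ≠ t.letter i} ⊆ insert j {i | u.letter i ≠ t.letter i} := by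
      intro i hi
      by_cases hij : i = j
      · exact Or.inl hij
      · right
        have := hj i hij
        simpa [← this] using hi
    have h1 := Set.ncard_le_ncard hsub ((finite_diff u t).insert j)
    have h2 := Set.ncard_insert_le j {i | u.letter i ≠ t.letter i}
    simp only [SimpleGraph.Walk.length_cons]
    omega

lemma exists_walk (n : ℕ) : ∀ s t : AString A, {j | s.letter j ≠ t.letter j}.ncard = n →
    ∃ w : (substGraph A).Walk s t, w.length = n := by
  classical
  induction n with
  | zero =>
    intro s t h
    have h0 := (Set.ncard_eq_zero (finite_diff s t)).1 h
    have : s = t := by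
      ext1
      funext j
      by_contra hj
      exact (Set.eq_empty_iff_forall_notMem.1 h0 j) hj
    subst this
    exact ⟨SimpleGraph.Walk.nil, rfl⟩
  | succ n ih =>
    intro s t h
    obtain ⟨j, hj, hmax⟩ : ∃ j, s.letter j ≠ t.letter j ∧
        ∀ i, j < i → s.letter i = t.letter i := by
      have hne : {j | s.letter j ≠ t.letter j}.Nonempty := by
        rw [Set.nonempty_iff_ne_empty]
        intro h0
        simp [h0] at h
      obtain ⟨j, hj, hm⟩ := Set.exists_max_image _ id (finite_diff s t) hne
      refine ⟨j, hj, fun i hi => ?_⟩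
      by_contra hne
      exact absurd (hm i hne) (not_le.2 hi)
    have key : ∀ s t : AString A, {j | s.letter j ≠ t.letter j}.ncard = n + 1 →
        s.letter j ≠ t.letter j → (∀ i, j < i → s.letter i = t.letter i) →
        s.letter j ≠ none → ∃ w : (substGraph A).Walk s t, w.length = n + 1 := by
      intro s t h hj hmax hs
      let u : AString A :=
        { letter := Function.update s.letter j (t.letter j)
          exists_empty := by
            obtain ⟨k, hk⟩ := s.exists_empty
            refine ⟨max k (j + 1), ?_⟩
            rw [Function.update_of_ne (by have := le_max_right k (j + 1); omega)]
            exact s.empty_of_le (le_max_left _ _) hk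
          empty_succ := by
            intro i hi
            by_cases h1 : i = j
            · subst h1
              rw [Function.update_self] at hi
              rw [Function.update_of_ne (by omega), hmax _ (by omega)]
              exact t.empty_succ _ hi
            · rw [Function.update_of_ne h1] at hi
              by_cases h2 : i + 1 = j
              · exact absurd (h2 ▸ s.empty_succ _ hi) hs
              · rw [Function.update_of_ne h2]
                exact s.empty_succ _ hi }
      have hu : ∀ i, i ≠ j → s.letter i = u.letter i := fun i hi =>
        (Function.update_of_ne hi _ _).symm
      have huj : u.letter j = t.letter j := Function.update_self _ _ _
      have hadj : (substGraph A).Adj s u := ⟨j, by rw [huj]; exact hj, hu⟩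
      have hset : {i | s.letter i ≠ t.letter i} = insert j {i | u.letter i ≠ t.letter i} := by
        ext i
        by_cases hij : i = j
        · subst hij; simp [hj]
        · simp [hij, hu i hij]
      have hcard : {i | u.letter i ≠ t.letter i}.ncard = n := by
        rw [hset, Set.ncard_insert_of_notMem (by simp [huj]) (finite_diff u t)] at h
        omega
      obtain ⟨w, hw⟩ := ih u t hcard
      exact ⟨SimpleGraph.Walk.cons hadj w, by simp [hw]⟩
    by_cases hs : s.letter j = none
    · obtain ⟨w, hw⟩ := key t s (by simpa only [ne_comm] using h) hj.symm
        (fun i hi => (hmax i hi).symm) (fun ht => hj (hs.trans ht.symm))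
      exact ⟨w.reverse, by simp [hw]⟩
    · exact key s t h hj hmax hs

/-- Any two strings are joined by substitutions, and the distance is the number of sites at
which they differ. -/
lemma extHamming_eq_ncard (s t : AString A) :
    extHamming s t = {j | s.letter j ≠ t.letter j}.ncard := by
  obtain ⟨w, hw⟩ := exists_walk _ s t rfl
  obtain ⟨w', hw'⟩ := SimpleGraph.Reachable.exists_walk_length_eq_dist ⟨w⟩
  apply le_antisymm
  · rw [← hw]; exact SimpleGraph.dist_le w
  · unfold extHamming
    rw [← hw']; exact ncard_diff_le_length w'

/-- The sphere of radius `r` around `s`. -/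
def sphere (s : AString A) (r : ℕ) : Set (AString A) := {t | extHamming s t = r}

/-- The probability function of the Laplace-like distribution with parameters `l` and `ρ`. -/
noncomputable def laplaceProb (l : AString A) (ρ : ℝ) (s : AString A) : ℝ :=
  1 / ((ρ + 1) * ((sphere l (extHamming s l)).ncard : ℝ)) *
    (ρ / (ρ + 1)) ^ extHamming s l

/-- The Laplace-like distribution with parameters `l` and `ρ`: the mass of a set of strings is
the sum of the values of the probability function on it. -/
noncomputable def laplaceLike (l : AString A) (ρ : ℝ) : Measure (AString A) :=
  Measure.sum fun s => ENNReal.ofReal (laplaceProb l ρ s) • Measure.dirac s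

section Sample

variable {n : ℕ} (s : Fin n → AString A)

/-- The likelihood of the parameters `l` and `ρ` given the observed strings. -/
noncomputable def likelihood (l : AString A) (ρ : ℝ) : ℝ := ∏ i, laplaceProb l ρ (s i)

/-- `(l, ρ)` is a maximum likelihood estimate: it maximizes the likelihood over all strings
and all positive reals. -/
def IsMLE (l : AString A) (ρ : ℝ) : Prop :=
  0 < ρ ∧ ∀ (l' : AString A) (ρ' : ℝ), 0 < ρ' → likelihood s l' ρ' ≤ likelihood s l ρ

open Classical in
/-- The relative frequency of the letter `x` at site `j`. -/
noncomputable def relFreq (j : ℕ) (x : Option A) : ℝ :=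
  ((Finset.univ.filter fun i => (s i).letter j = x).card : ℝ) / n

/-- The first site (counted from `0`) at which the empty letter has maximum relative frequency,
that is, the number of sites before it. -/
noncomputable def jStar : ℕ := sInf {j | ∀ x, relFreq s j x ≤ relFreq s j none}

/-- `j` is a site before `jStar` such that from `j` up to `jStar` the maximum and
the minimum relative frequency of the nonempty letters differ by less than `ε`. -/
def AlmostUniformFrom (ε : ℝ) (j : ℕ) : Prop :=
  j < jStar s ∧ ∀ j', j ≤ j' → j' < jStar s →
    (⨆ a : A, relFreq s j' (some a)) - (⨅ a : A, relFreq s j' (some a)) < ε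

open Classical in
/-- The length of the truncated consensus sequence. -/
noncomputable def truncLength (ε : ℝ) : ℕ :=
  if ∃ j, AlmostUniformFrom s ε j then sInf {j | AlmostUniformFrom s ε j} else jStar s

lemma truncLength_le (ε : ℝ) : truncLength s ε ≤ jStar s := by
  unfold truncLength
  split_ifs with h
  · exact (Nat.sInf_mem (s := {j | AlmostUniformFrom s ε j}) h).1.le
  · exact le_rfl

/-- `η` selects at each site a letter with maximum relative frequency. -/
def IsConsensusChoice (η : ℕ → Option A) : Prop := ∀ j x, relFreq s j x ≤ relFreq s j (η j)

/-- The truncated consensus sequence, for a choice `η` of letters with maximum relative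
frequency. -/
noncomputable def truncatedConsensus (ε : ℝ) (η : ℕ → Option A) (hη : IsConsensusChoice s η) :
    AString A where
  letter j := if j < truncLength s ε then η j else none
  exists_empty := ⟨truncLength s ε, by simp⟩
  empty_succ := by
    intro j hj
    by_cases h : j < truncLength s ε
    · rw [if_pos h] at hj
      have : j ∈ {j | ∀ x, relFreq s j x ≤ relFreq s j none} := fun x => hj ▸ hη j x
      exact absurd (Nat.sInf_le this) (not_le.2 (h.trans_le (truncLength_le s ε)))
    · rw [if_neg (by omega)]

end Sample

end AString

/-! For fixed `l'` the log-likelihood divided by `n` is `d log ρ' - (d + 1) log (ρ' + 1) - g`, where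
`d` is the mean distance of the sample from `l'` and `g` the mean of `logSphere l'`. For `d > 0` its
only maximum is at `ρ' = d`, with value `-geomEntropy d - g`, so estimating `l` means minimizing
`geomEntropy d + g` over `l'`. By the strong law this quantity tends to `crossEntropy l ρ l'`, whose
only minimizer is the true `l` by Gibbs' inequality (`crossEntropy_lt`). Infinitely many `l'` are
handled together because balls are finite, while far from `l` the triangle inequality makes `d`
large and `geomEntropy d ≥ log (d + 1)`, `g ≥ 0` (`eventually_crossEntropy_lt`). So eventually the
estimate is `l` with its mean distance (`isMLE_iff`).

It remains that the truncated consensus is eventually `l`. Spheres do not shrink as the radius grows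
(`ncard_sphere_succ`), so probability strictly decreases with the distance from `l`. Injections that
move strings closer to `l` show that at each site of `l` its letter is strictly the most probable
(`siteProb_lt`); beyond the end of `l` all nonempty letters are equiprobable by symmetry
(`siteProb_eq`). With `ε₀` below all the gaps, the limiting frequencies select the letters of `l`
and the truncation cuts exactly at its end (`truncatedConsensus_eq`). -/

namespace AString

variable {A : Type*}

/-! ### Lengths and the metric. -/

/-- The number of nonempty letters of a string. -/
noncomputable def length (s : AString A) : ℕ := sInf {h | s.letter h = none}

lemma letter_eq_none_iff (s : AString A) {j : ℕ} : s.letter j = none ↔ s.length ≤ j :=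
  ⟨fun h => Nat.sInf_le h,
    fun h => s.empty_of_le h (Nat.sInf_mem (s := {h | s.letter h = none}) s.exists_empty)⟩

lemma letter_ne_none_iff (s : AString A) {j : ℕ} : s.letter j ≠ none ↔ j < s.length := by
  rw [Ne, letter_eq_none_iff, not_le]

lemma length_eq_of_forall {s : AString A} {n : ℕ} (h : ∀ j, s.letter j = none ↔ n ≤ j) :
    s.length = n :=
  le_antisymm (s.letter_eq_none_iff.1 ((h n).2 le_rfl))
    ((h _).1 (s.letter_eq_none_iff.2 le_rfl))

lemma extHamming_self (s : AString A) : extHamming s s = 0 := by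
  simp [extHamming_eq_ncard]

lemma extHamming_comm (s t : AString A) : extHamming s t = extHamming t s := by
  simp only [extHamming_eq_ncard, ne_comm]

lemma extHamming_triangle (s t u : AString A) :
    extHamming s u ≤ extHamming s t + extHamming t u := by
  simp only [extHamming_eq_ncard]
  refine (Set.ncard_le_ncard (t := {j | s.letter j ≠ t.letter j} ∪ {j | t.letter j ≠ u.letter j})
    ?_ ((finite_diff s t).union (finite_diff t u))).trans (Set.ncard_union_le _ _)
  intro j hj
  by_cases h : s.letter j = t.letter j
  · right
    simpa [← h] using hj
  · exact Or.inl h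

lemma extHamming_eq_zero {s t : AString A} : extHamming s t = 0 ↔ s = t := by
  refine ⟨fun h => ?_, fun h => h ▸ extHamming_self s⟩
  rw [extHamming_eq_ncard, Set.ncard_eq_zero (finite_diff s t)] at h
  ext1
  funext j
  by_contra hj
  exact (Set.eq_empty_iff_forall_notMem.1 h j) hj

lemma length_le_add_extHamming (s t : AString A) : s.length ≤ t.length + extHamming s t := by
  rw [extHamming_eq_ncard]
  have hsub : Set.Ico t.length s.length ⊆ {j | s.letter j ≠ t.letter j} := by
    intro j hj heq
    exact s.letter_ne_none_iff.2 hj.2 (heq.trans (t.letter_eq_none_iff.2 hj.1))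
  have := Set.ncard_le_ncard hsub (finite_diff s t)
  rw [Set.ncard_eq_toFinset_card'] at this
  simp only [Set.toFinset_Ico, Nat.card_Ico] at this
  omega

/-! ### Transformations of strings and their effect on the distance. -/

/-- The string `s`, continued by the letters of `l` beyond its end, followed by `k` letters `a`. -/
noncomputable def glue (l s : AString A) (k : ℕ) (a : A) : AString A where
  letter j := if j < s.length then s.letter j else if j < l.length then l.letter j
    else if j < max s.length l.length + k then some a else none
  exists_empty := ⟨max s.length l.length + k, by
    have h1 := le_max_left s.length l.length
    have h2 := le_max_right s.length l.length
    rw [if_neg (by omega), if_neg (by omega), if_neg (by omega)]⟩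
  empty_succ := by
    intro j hj
    have h1 := le_max_left s.length l.length
    have h2 := le_max_right s.length l.length
    split_ifs at hj with h3 h4 h5
    · exact absurd hj (s.letter_ne_none_iff.2 h3)
    · exact absurd hj (l.letter_ne_none_iff.2 h4)
    · rw [if_neg (by omega), if_neg (by omega), if_neg (by omega)]

section glue

variable (l s : AString A) (k : ℕ) (a : A)

lemma glue_letter (j : ℕ) : (glue l s k a).letter j =
    if j < s.length then s.letter j else if j < l.length then l.letter j
    else if j < max s.length l.length + k then some a else none := rfl

lemma length_glue : (glue l s k a).length = max s.length l.length + k := by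
  refine length_eq_of_forall fun j => ?_
  have h1 := le_max_left s.length l.length
  have h2 := le_max_right s.length l.length
  rw [glue_letter]
  split_ifs with h3 h4 h5
  · simp only [s.letter_ne_none_iff.2 h3, false_iff]; omega
  · simp only [l.letter_ne_none_iff.2 h4, false_iff]; omega
  · simpa using h5
  · simpa using h5

lemma glue_letter_of_lt {j : ℕ} (hj : j < s.length) : (glue l s k a).letter j = s.letter j := by
  rw [glue_letter, if_pos hj]

lemma glue_letter_last : (glue l s (k + 1) a).letter (max s.length l.length + k) = some a := by
  have h1 := le_max_left s.length l.length
  have h2 := le_max_right s.length l.length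
  rw [glue_letter, if_neg (by omega), if_neg (by omega), if_pos (by omega)]

/-- Filling the gap with letters of `l` repairs `l.length - s.length` sites (truncated subtraction),
and each of the `k` appended letters lies beyond both strings and costs one. -/
lemma extHamming_glue :
    extHamming (glue l s k a) l + (l.length - s.length) = extHamming s l + k := by
  have h1 := le_max_left s.length l.length
  have h2 := le_max_right s.length l.length
  have hset : {j | (glue l s k a).letter j ≠ l.letter j} ∪ Set.Ico s.length l.length =
      {j | s.letter j ≠ l.letter j} ∪
        Set.Ico (max s.length l.length) (max s.length l.length + k) := by
    ext j
    simp only [Set.mem_union, Set.mem_ofPred_eq, Set.mem_Ico, glue_letter]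
    split_ifs with h3 h4 h5
    · have : ¬ s.length ≤ j := by omega
      have : ¬ max s.length l.length ≤ j := by omega
      simp [*]
    · have hs := s.letter_eq_none_iff.2 (not_lt.1 h3)
      have hl := l.letter_ne_none_iff.2 h4
      simp only [hs, ne_eq, not_true, false_or]
      simp only [Ne.symm hl, not_false_eq_true, true_or, iff_true]
      omega
    · have hl := l.letter_eq_none_iff.2 (not_lt.1 h4)
      simp only [hl, ne_eq, reduceCtorEq, not_false_eq_true, true_or, true_iff]
      right; omega
    · have hs := s.letter_eq_none_iff.2 (not_lt.1 h3)
      have hl := l.letter_eq_none_iff.2 (not_lt.1 h4)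
      simp only [hl, hs]
      simp only [ne_eq, not_true, false_or]
      omega
  have hd1 : Disjoint {j | (glue l s k a).letter j ≠ l.letter j}
      (Set.Ico s.length l.length) := by
    rw [Set.disjoint_left]
    intro j hj hj'
    apply hj
    rw [glue_letter, if_neg (by have := hj'.1; omega), if_pos hj'.2]
  have hd2 : Disjoint {j | s.letter j ≠ l.letter j}
      (Set.Ico (max s.length l.length) (max s.length l.length + k)) := by
    rw [Set.disjoint_left]
    intro j hj hj'
    exact hj ((s.letter_eq_none_iff.2 (by have := hj'.1; omega)).trans
      (l.letter_eq_none_iff.2 (by have := hj'.1; omega)).symm)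
  have := congrArg Set.ncard hset
  rw [Set.ncard_union_eq hd1 (finite_diff _ _) (Set.finite_Ico _ _),
    Set.ncard_union_eq hd2 (finite_diff _ _) (Set.finite_Ico _ _)] at this
  simpa [extHamming_eq_ncard, Set.ncard_eq_toFinset_card' (Set.Ico _ _)] using this

end glue

lemma eq_of_glue_eq {l s t : AString A} {k k' : ℕ} {a a' : A} (hlen : s.length = t.length)
    (h : glue l s k a = glue l t k' a') : s = t := by
  ext1
  funext j
  by_cases hj : j < s.length
  · rw [← glue_letter_of_lt l s k a hj, h, glue_letter_of_lt l t k' a' (hlen ▸ hj)]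
  · rw [s.letter_eq_none_iff.2 (not_lt.1 hj), t.letter_eq_none_iff.2 (hlen ▸ not_lt.1 hj)]

/-- Apply a permutation of the alphabet at the site `j`. -/
def permAt (j : ℕ) (e : Equiv.Perm A) (s : AString A) : AString A where
  letter i := if i = j then (s.letter i).map e else s.letter i
  exists_empty := by
    obtain ⟨h, hh⟩ := s.exists_empty
    exact ⟨h, by simp [hh]⟩
  empty_succ := by
    intro i hi
    have : s.letter i = none := by
      split_ifs at hi with h
      · simpa using hi
      · exact hi
    simp [s.empty_succ i this]

lemma permAt_letter_self (j : ℕ) (e : Equiv.Perm A) (s : AString A) :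
    (permAt j e s).letter j = (s.letter j).map e := if_pos rfl

lemma permAt_letter_of_ne {i j : ℕ} (h : i ≠ j) (e : Equiv.Perm A) (s : AString A) :
    (permAt j e s).letter i = s.letter i := if_neg h

lemma permAt_injective (j : ℕ) (e : Equiv.Perm A) : Function.Injective (permAt j e) := by
  intro s t h
  ext1
  funext i
  by_cases hi : i = j
  · subst hi
    have := congrArg (fun u => u.letter i) h
    simp only [permAt_letter_self] at this
    exact Option.map_injective e.injective this
  · rw [← permAt_letter_of_ne hi e s, h, permAt_letter_of_ne hi]

lemma extHamming_permAt_of_empty {j : ℕ} (e : Equiv.Perm A) (s : AString A) {l : AString A}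
    (hl : l.letter j = none) : extHamming (permAt j e s) l = extHamming s l := by
  simp only [extHamming_eq_ncard]
  congr 1
  ext i
  by_cases hi : i = j
  · subst hi
    simp [permAt_letter_self, hl]
  · simp [permAt_letter_of_ne hi]

lemma extHamming_permAt_add_one {j : ℕ} (e : Equiv.Perm A) {s l : AString A}
    (h : s.letter j ≠ l.letter j) (h' : (s.letter j).map e = l.letter j) :
    extHamming (permAt j e s) l + 1 = extHamming s l := by
  simp only [extHamming_eq_ncard]
  rw [← Set.ncard_insert_of_notMem (a := j) (by simp [permAt_letter_self, h']) (finite_diff _ _)]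
  congr 1
  ext i
  by_cases hi : i = j
  · subst hi
    simp [h]
  · simp [permAt_letter_of_ne hi, hi]

/-! ### Spheres: finiteness and growth. -/

lemma mem_sphere {s t : AString A} {r : ℕ} : t ∈ sphere s r ↔ extHamming t s = r := by
  rw [extHamming_comm]; rfl

/-- A string at distance `r` has length at most `s.length + r`. -/
lemma sphere_injOn (s : AString A) (r : ℕ) :
    Set.InjOn (fun (t : AString A) (i : Fin (s.length + r)) => t.letter i) (sphere s r) := by
  intro t ht u hu h
  have h1 := length_le_add_extHamming t s
  have h2 := length_le_add_extHamming u s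
  rw [mem_sphere.1 ht] at h1
  rw [mem_sphere.1 hu] at h2
  ext1
  funext j
  by_cases hj : j < s.length + r
  · exact congrFun h ⟨j, hj⟩
  · rw [t.letter_eq_none_iff.2 (by omega), u.letter_eq_none_iff.2 (by omega)]

section Finite

variable [Finite A]

lemma finite_sphere (s : AString A) (r : ℕ) : (sphere s r).Finite :=
  Set.Finite.of_injOn (Set.mapsTo_univ _ _) (sphere_injOn s r) Set.finite_univ

lemma ncard_sphere_le (s : AString A) (r : ℕ) :
    (sphere s r).ncard ≤ (Nat.card (Option A)) ^ (s.length + r) := by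
  have h := Set.ncard_le_ncard_of_injOn _ (fun t _ => Set.mem_univ _) (sphere_injOn s r)
    Set.finite_univ
  rwa [Set.ncard_univ, Nat.card_fun, Nat.card_fin] at h

lemma finite_ball (s : AString A) (r : ℕ) : {t | extHamming s t ≤ r}.Finite := by
  have : {t | extHamming s t ≤ r} = ⋃ i ∈ Set.Iic r, sphere s i := by
    ext t
    simp [sphere]
  rw [this]
  exact (Set.finite_Iic r).biUnion fun i _ => finite_sphere s i

variable (A) in
lemma countable_of_nonempty (s : AString A) : Countable (AString A) := by
  rw [← Set.countable_univ_iff]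
  have : (Set.univ : Set (AString A)) = ⋃ i, sphere s i := by
    ext t
    simp [sphere]
  rw [this]
  exact Set.countable_iUnion fun i => (finite_sphere s i).countable

variable [Nontrivial A]

/-- A string is filled up to the end of `l`, then lengthened by the number of filled sites plus one,
so its distance grows by exactly one. The new length leaves two candidates for the old one, shorter
than `l` or not; the last letter, `a` or `b`, decides between them. This needs two letters. -/
lemma ncard_sphere_succ (l : AString A) (r : ℕ) :
    (sphere l r).ncard ≤ (sphere l (r + 1)).ncard := by
  obtain ⟨a, b, hab⟩ := exists_pair_ne A
  set f : AString A → AString A := fun s =>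
    glue l s (l.length - s.length + 1) (if s.length < l.length then a else b) with hf
  refine Set.ncard_le_ncard_of_injOn f ?_ ?_ (finite_sphere _ _)
  · intro s hs
    rw [mem_sphere] at hs ⊢
    have := extHamming_glue l s (l.length - s.length + 1) (if s.length < l.length then a else b)
    rw [hf]
    simp only
    omega
  · intro s hs t ht h
    have hlen := congrArg length h
    simp only [hf, length_glue] at hlen
    have hlast : (f s).letter (max s.length l.length + (l.length - s.length)) =
        (f t).letter (max t.length l.length + (l.length - t.length)) := by
      rw [h]; congr 1; omega
    simp only [hf, glue_letter_last] at hlast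
    have hiff : s.length < l.length ↔ t.length < l.length := by
      split_ifs at hlast with h1 h2 h2
      · simp [h1, h2]
      · exact absurd (Option.some.inj hlast) hab
      · exact absurd (Option.some.inj hlast).symm hab
      · simp [h1, h2]
    exact eq_of_glue_eq (by omega) h

lemma ncard_sphere_pos (l : AString A) (r : ℕ) : 0 < (sphere l r).ncard := by
  induction r with
  | zero =>
    rw [Set.ncard_pos (finite_sphere _ _)]
    exact ⟨l, extHamming_self l⟩
  | succ r ih => exact ih.trans_le (ncard_sphere_succ l r)

lemma laplaceProb_pos (l s : AString A) {ρ : ℝ} (hρ : 0 < ρ) : 0 < laplaceProb l ρ s := by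
  have : (0 : ℝ) < (sphere l (extHamming s l)).ncard := by exact_mod_cast ncard_sphere_pos _ _
  unfold laplaceProb
  positivity

lemma laplaceProb_lt {l s t : AString A} {ρ : ℝ} (hρ : 0 < ρ)
    (h : extHamming s l < extHamming t l) : laplaceProb l ρ t < laplaceProb l ρ s := by
  have key : StrictAnti fun r : ℕ =>
      1 / ((ρ + 1) * ((sphere l r).ncard : ℝ)) * (ρ / (ρ + 1)) ^ r := by
    refine strictAnti_nat_of_succ_lt fun r => ?_
    have h1 : (0 : ℝ) < (sphere l r).ncard := by exact_mod_cast ncard_sphere_pos _ _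
    have h2 : ((sphere l r).ncard : ℝ) ≤ (sphere l (r + 1)).ncard := by
      exact_mod_cast ncard_sphere_succ l r
    have h3 : ρ / (ρ + 1) < 1 := by rw [div_lt_one (by positivity)]; linarith
    refine mul_lt_mul' ?_ (pow_lt_pow_right_of_lt_one₀ (by positivity) h3 r.lt_succ_self)
      (by positivity) (by positivity)
    gcongr
  exact key h

end Finite

/-! ### The Laplace-like distribution: total mass and integrability. -/

lemma lintegral_laplaceLike (l : AString A) (ρ : ℝ) (f : AString A → ENNReal) :
    ∫⁻ s, f s ∂laplaceLike l ρ = ∑' s, ENNReal.ofReal (laplaceProb l ρ s) * f s := by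
  rw [laplaceLike, lintegral_sum_measure]
  refine tsum_congr fun s => ?_
  rw [lintegral_smul_measure, lintegral_dirac' _ measurable_from_top, smul_eq_mul]

lemma laplaceLike_apply (l : AString A) (ρ : ℝ) (S : Set (AString A)) :
    laplaceLike l ρ S = ∑' s : S, ENNReal.ofReal (laplaceProb l ρ s) := by
  have h := lintegral_laplaceLike l ρ (S.indicator 1)
  rw [lintegral_indicator_one MeasurableSpace.measurableSet_top] at h
  rw [h, tsum_subtype S (fun s => ENNReal.ofReal (laplaceProb l ρ s))]
  refine tsum_congr fun s => ?_
  by_cases hs : s ∈ S <;> simp [hs]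

/-- The logarithm of the number of strings at the same distance from `l` as `s`. -/
noncomputable def logSphere (l s : AString A) : ℝ :=
  Real.log (sphere l (extHamming s l)).ncard

lemma logSphere_nonneg (l s : AString A) : 0 ≤ logSphere l s :=
  Real.log_natCast_nonneg _

/-- A string of given letters and given length. -/
def ofLength (f : ℕ → A) (n : ℕ) : AString A where
  letter j := if j < n then some (f j) else none
  exists_empty := ⟨n, by simp⟩
  empty_succ := by
    intro j hj
    split_ifs at hj with h
    rw [if_neg (by omega)]

lemma nonempty_letter_eq [Nonempty A] (j : ℕ) (x : Option A) : {s : AString A | s.letter j = x}.Nonempty := by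
  inhabit A
  cases x with
  | none => exact ⟨ofLength (fun _ => default) 0, by simp [ofLength]⟩
  | some a => exact ⟨ofLength (fun _ => a) (j + 1), by simp [ofLength]⟩

section Finite

variable [Finite A] [Nontrivial A] {l : AString A} {ρ : ℝ}

/-- The sphere size cancels the normalization on each sphere, so the distance from `l` is
geometrically distributed with ratio `ρ / (ρ + 1)`. -/
lemma tsum_laplaceProb_mul (l : AString A) (hρ : 0 < ρ) (F : ℕ → ENNReal) :
    ∑' s, ENNReal.ofReal (laplaceProb l ρ s) * F (extHamming s l) =
      ∑' r : ℕ, ENNReal.ofReal (1 / (ρ + 1) * (ρ / (ρ + 1)) ^ r) * F r := by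
  rw [← (Equiv.sigmaFiberEquiv fun s => extHamming s l).tsum_eq, ENNReal.tsum_sigma']
  refine tsum_congr fun r => ?_
  have h : ∀ s : {s // extHamming s l = r},
      ENNReal.ofReal (laplaceProb l ρ (Equiv.sigmaFiberEquiv (fun s => extHamming s l) ⟨r, s⟩)) *
        F (extHamming (Equiv.sigmaFiberEquiv (fun s => extHamming s l) ⟨r, s⟩) l) =
      ENNReal.ofReal (1 / ((ρ + 1) * ((sphere l r).ncard : ℝ)) * (ρ / (ρ + 1)) ^ r) * F r := by
    rintro ⟨s, rfl⟩
    rfl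
  rw [tsum_congr h, ENNReal.tsum_const]
  have hset : {s | extHamming s l = r} = sphere l r := by
    ext s
    exact mem_sphere.symm
  have hcard : ENat.card {s // extHamming s l = r} = ((sphere l r).ncard : ℕ∞) := by
    rw [(finite_sphere l r).cast_ncard_eq, ← hset]
    rfl
  have h1 : (0 : ℝ) < (sphere l r).ncard := by exact_mod_cast ncard_sphere_pos l r
  rw [hcard, ← mul_assoc]
  congr 1
  rw [ENat.toENNReal_coe, ← ENNReal.ofReal_natCast, ← ENNReal.ofReal_mul (by positivity)]
  congr 1
  field_simp

lemma tsum_laplaceProb (l : AString A) (hρ : 0 < ρ) :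
    ∑' s, ENNReal.ofReal (laplaceProb l ρ s) = 1 := by
  have h := tsum_laplaceProb_mul l hρ (fun _ => 1)
  simp only [mul_one] at h
  have h3 : ρ / (ρ + 1) < 1 := by rw [div_lt_one (by positivity)]; linarith
  rw [h, ← ENNReal.ofReal_tsum_of_nonneg (fun r => by positivity)
    ((summable_geometric_of_lt_one (by positivity) h3).mul_left _), tsum_mul_left,
    tsum_geometric_of_lt_one (by positivity) h3]
  rw [ENNReal.ofReal_eq_one]
  field_simp
  ring

lemma isProbabilityMeasure_laplaceLike (l : AString A) (hρ : 0 < ρ) :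
    IsProbabilityMeasure (laplaceLike l ρ) := by
  constructor
  rw [← lintegral_one, lintegral_laplaceLike]
  simpa using tsum_laplaceProb l hρ

lemma integrable_extHamming_self (l : AString A) (hρ : 0 < ρ) :
    Integrable (fun s => (extHamming s l : ℝ)) (laplaceLike l ρ) := by
  refine ⟨measurable_from_top.aestronglyMeasurable, ?_⟩
  have h3 : ρ / (ρ + 1) < 1 := by rw [div_lt_one (by positivity)]; linarith
  have hsum : Summable fun r : ℕ => 1 / (ρ + 1) * (ρ / (ρ + 1)) ^ r * (r : ℝ) := by
    have h := summable_pow_mul_geometric_of_norm_lt_one 1 (r := ρ / (ρ + 1))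
      (by rwa [Real.norm_of_nonneg (by positivity)])
    refine (h.mul_left (1 / (ρ + 1))).congr fun r => ?_
    ring
  rw [hasFiniteIntegral_iff_ofReal (Filter.Eventually.of_forall fun s => Nat.cast_nonneg _),
    lintegral_laplaceLike,
    tsum_laplaceProb_mul l hρ (fun r => ENNReal.ofReal (r : ℝ))]
  simp_rw [← ENNReal.ofReal_mul (show 0 ≤ 1 / (ρ + 1) * (ρ / (ρ + 1)) ^ _ by positivity)]
  rw [← ENNReal.ofReal_tsum_of_nonneg (fun r => by positivity) hsum]
  exact ENNReal.ofReal_lt_top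

/-- A function which grows at most linearly in the distance is integrable. -/
lemma integrable_of_le_linear (hρ : 0 < ρ) {g : AString A → ℝ} {C D : ℝ}
    (hg : ∀ s, |g s| ≤ C + D * extHamming s l) : Integrable g (laplaceLike l ρ) := by
  have := isProbabilityMeasure_laplaceLike l hρ
  refine Integrable.mono' ((integrable_const C).add
    ((integrable_extHamming_self l hρ).const_mul D))
    measurable_from_top.aestronglyMeasurable (Filter.Eventually.of_forall hg)

lemma integrable_extHamming (l l' : AString A) (hρ : 0 < ρ) :
    Integrable (fun s => (extHamming s l' : ℝ)) (laplaceLike l ρ) := by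
  refine integrable_of_le_linear hρ (C := extHamming l l') (D := 1) fun s => ?_
  rw [abs_of_nonneg (Nat.cast_nonneg _)]
  have := extHamming_triangle s l l'
  rw [one_mul]
  exact_mod_cast this.trans_eq (add_comm _ _)

lemma logSphere_le (l s : AString A) :
    logSphere l s ≤ (l.length + extHamming s l) * Real.log (Nat.card (Option A)) := by
  have h1 : (0 : ℝ) < (sphere l (extHamming s l)).ncard := by
    exact_mod_cast ncard_sphere_pos _ _
  have h2 : ((sphere l (extHamming s l)).ncard : ℝ) ≤
      (Nat.card (Option A) : ℝ) ^ (l.length + extHamming s l) := by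
    exact_mod_cast ncard_sphere_le l _
  have h := Real.log_le_log h1 h2
  rw [Real.log_pow] at h
  exact_mod_cast h

lemma integrable_logSphere (l l' : AString A) (hρ : 0 < ρ) :
    Integrable (logSphere l') (laplaceLike l ρ) := by
  set c := Real.log (Nat.card (Option A)) with hc
  have hc0 : 0 ≤ c := Real.log_natCast_nonneg _
  refine integrable_of_le_linear hρ (C := (l'.length + extHamming l l') * c) (D := c) fun s => ?_
  rw [abs_of_nonneg (logSphere_nonneg _ _)]
  have h : (extHamming s l' : ℝ) ≤ extHamming s l + extHamming l l' := by
    exact_mod_cast extHamming_triangle s l l'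
  have h2 := logSphere_le l' s
  rw [← hc] at h2
  nlinarith

/-- Each string of `S` is exchanged, without collisions, for a strictly more probable one in `T`. -/
lemma laplaceLike_lt_of_injOn {S T : Set (AString A)} (hρ : 0 < ρ) (hS : S.Nonempty)
    (f : AString A → AString A) (hf : Set.InjOn f S) (hST : Set.MapsTo f S T)
    (hlt : ∀ s ∈ S, extHamming (f s) l < extHamming s l) :
    laplaceLike l ρ S < laplaceLike l ρ T := by
  have := isProbabilityMeasure_laplaceLike l hρ
  obtain ⟨s₀, hs₀⟩ := hS
  have hfin : laplaceLike l ρ S ≠ ⊤ := measure_ne_top _ _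
  rw [laplaceLike_apply] at hfin ⊢
  rw [laplaceLike_apply]
  have h1 : ∑' s : S, ENNReal.ofReal (laplaceProb l ρ s) <
      ∑' s : S, ENNReal.ofReal (laplaceProb l ρ (f s)) := by
    refine ENNReal.tsum_lt_tsum (i := ⟨s₀, hs₀⟩) hfin (fun s => ?_) ?_
    · exact ENNReal.ofReal_le_ofReal (laplaceProb_lt hρ (hlt s s.2)).le
    · exact (ENNReal.ofReal_lt_ofReal_iff (laplaceProb_pos _ _ hρ)).2
        (laplaceProb_lt hρ (hlt s₀ hs₀))
  refine h1.trans_le ?_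
  exact ENNReal.tsum_comp_le_tsum_of_injective (f := hST.restrict f S T)
    (hST.restrict_inj.2 hf) (fun s : T => ENNReal.ofReal (laplaceProb l ρ s))

/-! ### Letter probabilities at a site. -/

/-- The probability of the letter `x` at site `j`. -/
noncomputable def siteProb (l : AString A) (ρ : ℝ) (j : ℕ) (x : Option A) : ℝ :=
  (laplaceLike l ρ).real {s | s.letter j = x}

lemma siteProb_lt (hρ : 0 < ρ) {j : ℕ} (hj : j < l.length) {x : Option A}
    (hx : x ≠ l.letter j) : siteProb l ρ j x < siteProb l ρ j (l.letter j) := by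
  classical
  have := isProbabilityMeasure_laplaceLike l hρ
  refine (ENNReal.toReal_lt_toReal (measure_ne_top _ _) (measure_ne_top _ _)).2 ?_
  obtain ⟨b, hb⟩ := Option.ne_none_iff_exists'.1 (l.letter_ne_none_iff.2 hj)
  cases x with
  | none =>
    -- Appending one letter fewer than were filled in lowers the distance by one, and the total
    -- length still encodes the length of `s`.
    refine laplaceLike_lt_of_injOn hρ (nonempty_letter_eq _ _)
      (fun s => glue l s (l.length - s.length - 1) b) ?_ ?_ ?_
    · intro s hs t ht h
      have hlen := congrArg length h
      have h1 := s.letter_eq_none_iff.1 hs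
      have h2 := t.letter_eq_none_iff.1 ht
      simp only [length_glue] at hlen
      exact eq_of_glue_eq (by omega) h
    · intro s hs
      have h1 := s.letter_eq_none_iff.1 hs
      change (glue l s _ b).letter j = _
      rw [glue_letter, if_neg (by omega), if_pos hj]
    · intro s hs
      have h1 := s.letter_eq_none_iff.1 hs
      have := extHamming_glue l s (l.length - s.length - 1) b
      omega
  | some a =>
    refine laplaceLike_lt_of_injOn hρ (nonempty_letter_eq _ _)
      (permAt j (Equiv.swap a b)) (permAt_injective _ _).injOn ?_ ?_
    · intro s hs
      have hs : s.letter j = some a := hs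
      change (permAt j _ s).letter j = _
      rw [permAt_letter_self, hs, hb]
      simp
    · intro s hs
      have hs : s.letter j = some a := hs
      have := extHamming_permAt_add_one (j := j) (Equiv.swap a b) (s := s) (l := l)
        (by rw [hs]; exact hx) (by rw [hs, hb]; simp)
      omega

/-- Where `l` is empty, swapping two letters at the site preserves the distance from `l`. -/
lemma siteProb_eq (hρ : 0 < ρ) {j : ℕ} (hj : l.length ≤ j) (a b : A) :
    siteProb l ρ j (some a) = siteProb l ρ j (some b) := by
  classical
  have := isProbabilityMeasure_laplaceLike l hρ
  have key : ∀ a b : A, laplaceLike l ρ {s | s.letter j = some a} ≤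
      laplaceLike l ρ {s | s.letter j = some b} := by
    intro a b
    have hST : Set.MapsTo (permAt j (Equiv.swap a b)) {s | s.letter j = some a}
        {s | s.letter j = some b} := by
      intro s hs
      have hs : s.letter j = some a := hs
      change (permAt j _ s).letter j = _
      rw [permAt_letter_self, hs]
      simp
    rw [laplaceLike_apply, laplaceLike_apply]
    have h : ∀ s : {s : AString A | s.letter j = some a},
        ENNReal.ofReal (laplaceProb l ρ s) =
        ENNReal.ofReal (laplaceProb l ρ (hST.restrict _ _ _ s)) := by
      intro s
      have := extHamming_permAt_of_empty (Equiv.swap a b) s.1 (l.letter_eq_none_iff.2 hj)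
      simp only [Set.MapsTo.val_restrict_apply, laplaceProb, this]
    rw [tsum_congr h]
    exact ENNReal.tsum_comp_le_tsum_of_injective
      (hST.restrict_inj.2 (permAt_injective _ _).injOn)
      (fun s : {s : AString A | s.letter j = some b} => ENNReal.ofReal (laplaceProb l ρ s))
  exact congrArg ENNReal.toReal ((key a b).antisymm (key b a))

lemma exists_siteProb_none_gt (l : AString A) (hρ : 0 < ρ) :
    ∃ j, ∀ a : A, siteProb l ρ j (some a) < siteProb l ρ j none := by
  have := isProbabilityMeasure_laplaceLike l hρ
  have hmono : Monotone fun j => {s : AString A | s.letter j = none} :=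
    fun i j hij s hs => s.empty_of_le hij hs
  have hlim := tendsto_measure_iUnion_atTop (μ := laplaceLike l ρ) hmono
  have hun : ⋃ j, {s : AString A | s.letter j = none} = Set.univ := by
    ext s
    simpa using s.exists_empty
  rw [hun, measure_univ] at hlim
  have hlim' := (ENNReal.tendsto_toReal ENNReal.one_ne_top).comp hlim
  obtain ⟨j, hj⟩ := (hlim'.eventually (lt_mem_nhds (show (1 / 2 : ℝ) < ENNReal.toReal 1 by
    norm_num))).exists
  refine ⟨j, fun a => ?_⟩
  have hj : 1 / 2 < siteProb l ρ j none := hj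
  have hdisj : Disjoint {s : AString A | s.letter j = some a} {s | s.letter j = none} := by
    rw [Set.disjoint_left]
    intro s (hs : s.letter j = some a) (hs' : s.letter j = none)
    simp [hs] at hs'
  have hun := measureReal_union (μ := laplaceLike l ρ) hdisj MeasurableSpace.measurableSet_top
  have hle : (laplaceLike l ρ).real ({s : AString A | s.letter j = some a} ∪
    {s | s.letter j = none}) ≤ 1 := measureReal_le_one
  unfold siteProb at hj ⊢
  linarith

end Finite

/-! ### The strong law for functions of the sample. -/

lemma ae_tendsto_average {Ω : Type*} [MeasurableSpace Ω] {P : Measure Ω}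
    {μ : Measure (AString A)} {σ : ℕ → Ω → AString A} (hmeas : ∀ i, Measurable (σ i))
    (hindep : iIndepFun σ P) (hlaw : ∀ i, P.map (σ i) = μ) {g : AString A → ℝ}
    (hg : Integrable g μ) :
    ∀ᵐ ω ∂P, Filter.Tendsto (fun n : ℕ => (∑ i ∈ Finset.range n, g (σ i ω)) / n) Filter.atTop
      (nhds (∫ t, g t ∂μ)) := by
  have hgm : Measurable g := measurable_from_top
  have h := strong_law_ae_real (μ := P) (fun i ω => g (σ i ω)) ?_ ?_ ?_
  · have h0 : ∫ t, g t ∂μ = ∫ ω, g (σ 0 ω) ∂P := by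
      rw [← hlaw 0, integral_map (hmeas 0).aemeasurable hgm.aestronglyMeasurable]
    rw [h0]
    exact h
  · rw [← hlaw 0] at hg
    exact hg.comp_measurable (hmeas 0)
  · intro i j hij
    exact (hindep.indepFun hij).comp hgm hgm
  · intro i
    have hid : IdentDistrib (σ i) (σ 0) P P :=
      ⟨(hmeas i).aemeasurable, (hmeas 0).aemeasurable, (hlaw i).trans (hlaw 0).symm⟩
    exact hid.comp hgm

lemma relFreq_eq_average {n : ℕ} {s : Fin n → AString A} {x : ℕ → AString A}
    (hs : ∀ i, s i = x i) (j : ℕ) (y : Option A) :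
    relFreq s j y = (∑ i ∈ Finset.range n, {t : AString A | t.letter j = y}.indicator 1 (x i)) / n
      := by
  classical
  rw [relFreq, Finset.sum_range, Finset.card_filter]
  push_cast
  congr 1
  refine Finset.sum_congr rfl fun i _ => ?_
  by_cases h : (x i).letter j = y <;> simp [hs, h]

/-! ### Consistency of the truncated consensus. -/

section Consensus

variable [Finite A] [Nontrivial A] {l : AString A}

/-- The site `J` bounds `jStar`, so flatness of the frequencies is needed only at the finitely many
sites from `l.length` up to `J`. -/
lemma truncatedConsensus_eq {n : ℕ} {s : Fin n → AString A} {ε : ℝ} {J : ℕ}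
    (hmax : ∀ j < l.length, ∀ x, x ≠ l.letter j → relFreq s j x < relFreq s j (l.letter j))
    (hgap : ∀ j < l.length, ∀ a b, l.letter j = some a → b ≠ a →
      ε ≤ relFreq s j (some a) - relFreq s j (some b))
    (hJ : ∀ x, relFreq s J x ≤ relFreq s J none)
    (hflat : ∀ j, l.length ≤ j → j < J → ∀ a b,
      relFreq s j (some a) - relFreq s j (some b) < ε)
    (η : ℕ → Option A) (hη : IsConsensusChoice s η) :
    truncatedConsensus s ε η hη = l := by
  have hJmem : J ∈ {j | ∀ x, relFreq s j x ≤ relFreq s j none} := hJ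
  have hle : jStar s ≤ J := Nat.sInf_le hJmem
  have hge : l.length ≤ jStar s := by
    by_contra hlt
    rw [not_le] at hlt
    have hmem : ∀ x, relFreq s (jStar s) x ≤ relFreq s (jStar s) none :=
      Nat.sInf_mem (s := {j | ∀ x, relFreq s j x ≤ relFreq s j none}) ⟨J, hJmem⟩
    exact absurd (hmem (l.letter (jStar s)))
      (not_le.2 (hmax _ hlt none (l.letter_ne_none_iff.2 hlt).symm))
  have hnot : ∀ j, AlmostUniformFrom s ε j → l.length ≤ j := by
    intro j hj
    by_contra hlt
    rw [not_le] at hlt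
    obtain ⟨a, ha⟩ := Option.ne_none_iff_exists'.1 (l.letter_ne_none_iff.2 hlt)
    obtain ⟨b, hb⟩ := exists_ne a
    have h1 := hj.2 j le_rfl hj.1
    have h2 := hgap j hlt a b ha hb
    have h3 := le_ciSup (Set.finite_range fun a : A => relFreq s j (some a)).bddAbove a
    have h4 := ciInf_le (Set.finite_range fun a : A => relFreq s j (some a)).bddBelow b
    linarith
  have htrunc : truncLength s ε = l.length := by
    unfold truncLength
    -- If `jStar` is already the length of `l`, no site is almost uniform and nothing is cut;
    -- otherwise `l.length` is the first such site.
    rcases hge.eq_or_lt with heq | hlt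
    · rw [if_neg, ← heq]
      rintro ⟨j, hj⟩
      exact absurd (hnot j hj) (not_le.2 (heq ▸ hj.1))
    · have hL : AlmostUniformFrom s ε l.length := by
        refine ⟨hlt, fun j hj hj' => ?_⟩
        obtain ⟨a, ha⟩ := exists_eq_ciSup_of_finite (f := fun a : A => relFreq s j (some a))
        obtain ⟨b, hb⟩ := exists_eq_ciInf_of_finite (f := fun a : A => relFreq s j (some a))
        rw [← ha, ← hb]
        exact hflat j hj (hj'.trans_le hle) a b
      rw [if_pos ⟨_, hL⟩]
      exact le_antisymm (Nat.sInf_le hL)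
        (hnot _ (Nat.sInf_mem (s := {j | AlmostUniformFrom s ε j}) ⟨_, hL⟩))
  ext1
  funext j
  change (if j < truncLength s ε then η j else none) = _
  rw [htrunc]
  split_ifs with h
  · by_contra hne
    exact absurd (hη j (l.letter j)) (not_le.2 (hmax j h _ hne))
  · exact (l.letter_eq_none_iff.2 (not_lt.1 h)).symm

/-- Finitely many positive gaps; taking `ε₀` near zero rather than as a minimum also covers the
empty `l`. -/
lemma exists_siteProb_gap (l : AString A) {ρ : ℝ} (hρ : 0 < ρ) :
    ∃ ε₀ : ℝ, 0 < ε₀ ∧ ∀ j < l.length, ∀ x, x ≠ l.letter j →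
      ε₀ < siteProb l ρ j (l.letter j) - siteProb l ρ j x := by
  have hfin : (Set.Iio l.length ×ˢ (Set.univ : Set (Option A))).Finite :=
    (Set.finite_Iio _).prod Set.finite_univ
  have hev : ∀ᶠ ε in nhdsWithin (0 : ℝ) (Set.Ioi 0),
      ∀ p ∈ Set.Iio l.length ×ˢ (Set.univ : Set (Option A)), p.2 ≠ l.letter p.1 →
        ε < siteProb l ρ p.1 (l.letter p.1) - siteProb l ρ p.1 p.2 := by
    rw [Filter.eventually_all_finite hfin]
    rintro ⟨j, x⟩ ⟨hj, -⟩
    by_cases hx : x = l.letter j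
    · exact Filter.Eventually.of_forall fun _ h => absurd hx h
    · refine nhdsWithin_le_nhds ((gt_mem_nhds (sub_pos.2 (siteProb_lt hρ hj hx))).mono
        fun ε h _ => h)
  obtain ⟨ε, h, hε⟩ := (hev.and self_mem_nhdsWithin).exists
  exact ⟨ε, hε, fun j hj x hx => h (j, x) ⟨hj, trivial⟩ hx⟩

/-- If all relative frequencies converge to the site probabilities, then the truncated consensus
sequence is eventually equal to the parameter of the distribution. -/
lemma eventually_truncatedConsensus_eq {ρ ε : ℝ} (hρ : 0 < ρ) (hε : 0 < ε)
    (hgap : ∀ j < l.length, ∀ x, x ≠ l.letter j →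
      ε < siteProb l ρ j (l.letter j) - siteProb l ρ j x)
    {x : ℕ → AString A}
    (hx : ∀ j y, Filter.Tendsto (fun n : ℕ => (∑ i ∈ Finset.range n,
      {t : AString A | t.letter j = y}.indicator (1 : AString A → ℝ) (x i)) / n) Filter.atTop
      (nhds (siteProb l ρ j y))) :
    ∀ᶠ n : ℕ in Filter.atTop, ∀ s : Fin n → AString A, (∀ i, s i = x i) →
      ∀ η (hη : IsConsensusChoice s η), truncatedConsensus s ε η hη = l := by
  obtain ⟨J, hJ⟩ := exists_siteProb_none_gt l hρ
  set F : ℕ → ℕ → Option A → ℝ := fun n j y => (∑ i ∈ Finset.range n,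
      {t : AString A | t.letter j = y}.indicator (1 : AString A → ℝ) (x i)) / n with hF
  have hdiff : ∀ j y z, Filter.Tendsto (fun n => F n j y - F n j z) Filter.atTop
      (nhds (siteProb l ρ j y - siteProb l ρ j z)) := fun j y z => (hx j y).sub (hx j z)
  have h1 : ∀ᶠ n in Filter.atTop, ∀ j ∈ Set.Iio l.length, ∀ y, y ≠ l.letter j →
      ε < F n j (l.letter j) - F n j y := by
    rw [Filter.eventually_all_finite (Set.finite_Iio _)]
    intro j hj
    rw [Filter.eventually_all]
    intro y
    by_cases hy : y = l.letter j
    · exact Filter.Eventually.of_forall fun _ h => absurd hy h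
    · exact ((hdiff j _ y).eventually (lt_mem_nhds (hgap j hj y hy))).mono fun _ h _ => h
  have h2 : ∀ᶠ n in Filter.atTop, ∀ a : A, F n J (some a) < F n J none := by
    rw [Filter.eventually_all]
    intro a
    exact (hx J (some a)).eventually_lt (hx J none) (hJ a)
  have h3 : ∀ᶠ n in Filter.atTop, ∀ j ∈ Set.Ico l.length J, ∀ a b : A,
      F n j (some a) - F n j (some b) < ε := by
    rw [Filter.eventually_all_finite (Set.finite_Ico _ _)]
    intro j hj
    rw [Filter.eventually_all]
    intro a
    rw [Filter.eventually_all]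
    intro b
    refine (hdiff j (some a) (some b)).eventually (gt_mem_nhds ?_)
    rwa [siteProb_eq hρ hj.1 a b, sub_self]
  filter_upwards [h1, h2, h3] with n h1 h2 h3 s hs η hη
  have hrel : ∀ j y, relFreq s j y = F n j y := relFreq_eq_average hs
  refine truncatedConsensus_eq (J := J) ?_ ?_ ?_ ?_ η hη
  · intro j hj y hy
    have := h1 j hj y hy
    simp only [hrel]
    linarith
  · intro j hj a b ha hb
    have := h1 j hj (some b) (by rw [ha]; simpa using hb)
    rw [hrel, hrel, ← ha]
    exact this.le
  · rintro (_ | a)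
    · exact le_rfl
    · rw [hrel, hrel]
      exact (h2 a).le
  · intro j hj hj' a b
    rw [hrel, hrel]
    exact h3 j ⟨hj, hj'⟩ a b

end Consensus

/-! ### The likelihood maximized over the concentration parameter. -/

/-- The entropy of the geometric distribution with mean `x`. -/
noncomputable def geomEntropy (x : ℝ) : ℝ := (x + 1) * Real.log (x + 1) - x * Real.log x

lemma continuous_geomEntropy : Continuous geomEntropy :=
  (Real.continuous_mul_log.comp (continuous_add_const 1)).sub Real.continuous_mul_log

lemma log_add_one_le_geomEntropy {x : ℝ} (hx : 0 ≤ x) : Real.log (x + 1) ≤ geomEntropy x := by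
  unfold geomEntropy
  rcases hx.eq_or_lt with rfl | hx
  · simp
  · have := Real.log_le_log hx (show x ≤ x + 1 by linarith)
    nlinarith

/-- The difference of the two sides is the relative entropy of the geometric distributions with
means `x` and `ρ`. -/
lemma mul_log_sub_lt_neg_geomEntropy {x ρ : ℝ} (hx : 0 < x) (hρ : 0 < ρ) (hne : ρ ≠ x) :
    x * Real.log ρ - (x + 1) * Real.log (ρ + 1) < -geomEntropy x := by
  have h1 : Real.log (ρ * (x + 1) / (x * (ρ + 1))) ≤ ρ * (x + 1) / (x * (ρ + 1)) - 1 :=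
    Real.log_le_sub_one_of_pos (by positivity)
  have h2 : Real.log ((x + 1) / (ρ + 1)) < (x + 1) / (ρ + 1) - 1 := by
    refine Real.log_lt_sub_one_of_pos (by positivity) ?_
    rw [Ne, div_eq_one_iff_eq (by positivity)]
    intro h
    exact hne (by linarith)
  rw [Real.log_div (by positivity) (by positivity), Real.log_mul (by positivity) (by positivity),
    Real.log_mul (by positivity) (by positivity)] at h1
  rw [Real.log_div (by positivity) (by positivity)] at h2
  have h3 := mul_le_mul_of_nonneg_left h1 hx.le
  -- The bounds from `log t ≤ t - 1`, weighted by `x` and `1`, cancel.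
  have h4 : x * (ρ * (x + 1) / (x * (ρ + 1)) - 1) + ((x + 1) / (ρ + 1) - 1) = 0 := by
    field_simp
    ring
  unfold geomEntropy
  linarith

lemma mul_log_sub_le_neg_geomEntropy {x ρ : ℝ} (hx : 0 ≤ x) (hρ : 0 < ρ) :
    x * Real.log ρ - (x + 1) * Real.log (ρ + 1) ≤ -geomEntropy x := by
  rcases hx.eq_or_lt with rfl | hx
  · have := Real.log_nonneg (show 1 ≤ ρ + 1 by linarith)
    simp only [geomEntropy]
    norm_num
    exact this
  · by_cases hne : ρ = x
    · subst hne
      simp [geomEntropy]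
    · exact (mul_log_sub_lt_neg_geomEntropy hx hρ hne).le

variable [Finite A] [Nontrivial A]

lemma log_laplaceProb (l s : AString A) {ρ : ℝ} (hρ : 0 < ρ) :
    Real.log (laplaceProb l ρ s) = extHamming s l * Real.log ρ -
      (extHamming s l + 1) * Real.log (ρ + 1) - logSphere l s := by
  have h1 : (0 : ℝ) < (sphere l (extHamming s l)).ncard := by
    exact_mod_cast ncard_sphere_pos _ _
  rw [laplaceProb, logSphere, Real.log_mul (by positivity) (by positivity),
    Real.log_div (by positivity) (by positivity), Real.log_mul (by positivity) (by positivity),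
    Real.log_pow, Real.log_div (by positivity) (by positivity), Real.log_one]
  ring

section Sample

variable {n : ℕ} (s : Fin n → AString A)

lemma likelihood_pos (l : AString A) {ρ : ℝ} (hρ : 0 < ρ) : 0 < likelihood s l ρ :=
  Finset.prod_pos fun _ _ => laplaceProb_pos _ _ hρ

lemma log_likelihood (hn : 0 < n) (l : AString A) {ρ : ℝ} (hρ : 0 < ρ) {d g : ℝ}
    (hd : d = (∑ i, (extHamming (s i) l : ℝ)) / n) (hg : g = (∑ i, logSphere l (s i)) / n) :
    Real.log (likelihood s l ρ) =
      n * (d * Real.log ρ - (d + 1) * Real.log (ρ + 1) - g) := by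
  have hn' : (n : ℝ) ≠ 0 := by positivity
  rw [likelihood, Real.log_prod fun i _ => (laplaceProb_pos _ _ hρ).ne']
  simp_rw [log_laplaceProb _ _ hρ]
  rw [Finset.sum_sub_distrib, Finset.sum_sub_distrib, ← Finset.sum_mul, ← Finset.sum_mul,
    Finset.sum_add_distrib, hd, hg]
  simp only [Finset.sum_const, Finset.card_univ, Fintype.card_fin, nsmul_eq_mul, mul_one]
  field_simp

lemma isMLE_iff (hn : 0 < n) {l : AString A} {d g : AString A → ℝ}
    (hd : ∀ l, d l = (∑ i, (extHamming (s i) l : ℝ)) / n)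
    (hg : ∀ l, g l = (∑ i, logSphere l (s i)) / n) (hpos : 0 < d l)
    (hlt : ∀ l', l' ≠ l → geomEntropy (d l) + g l < geomEntropy (d l') + g l')
    (l' : AString A) (ρ' : ℝ) : IsMLE s l' ρ' ↔ l' = l ∧ ρ' = d l := by
  have hn' : (0 : ℝ) < n := by positivity
  have hself : Real.log (likelihood s l (d l)) = n * (-geomEntropy (d l) - g l) := by
    rw [log_likelihood s hn l hpos (hd l) (hg l), geomEntropy]
    ring
  have key : ∀ (l' : AString A) (ρ' : ℝ), 0 < ρ' → ¬(l' = l ∧ ρ' = d l) →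
      likelihood s l' ρ' < likelihood s l (d l) := by
    intro l' ρ' hρ' hne
    rw [← Real.log_lt_log_iff (likelihood_pos s _ hρ') (likelihood_pos s _ hpos), hself,
      log_likelihood s hn l' hρ' (hd l') (hg l')]
    refine mul_lt_mul_of_pos_left ?_ hn'
    by_cases hl : l' = l
    · subst hl
      have := mul_log_sub_lt_neg_geomEntropy hpos hρ' (fun h => hne ⟨rfl, h⟩)
      linarith
    -- Here `d l'` may vanish; the weak bound suffices since strictness comes from `hlt`.
    · have hd0 : 0 ≤ d l' := by
        rw [hd]
        positivity
      have h1 := mul_log_sub_le_neg_geomEntropy hd0 hρ'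
      have h2 := hlt l' hl
      linarith
  constructor
  · rintro ⟨h1, h2⟩
    by_contra hne
    exact absurd (h2 l (d l) hpos) (not_le.2 (key l' ρ' h1 hne))
  · rintro ⟨rfl, rfl⟩
    refine ⟨hpos, fun l'' ρ'' h => ?_⟩
    by_cases hne : l'' = l' ∧ ρ'' = d l'
    · rw [hne.1, hne.2]
    · exact (key l'' ρ'' h hne).le

end Sample

/-! ### The limit problem and uniformity over all strings. -/

section Limit

variable {l : AString A} {ρ : ℝ}

/-- The expected distance from `l'` under the Laplace-like distribution. -/
noncomputable def meanDist (l : AString A) (ρ : ℝ) (l' : AString A) : ℝ :=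
  ∫ s, (extHamming s l' : ℝ) ∂laplaceLike l ρ

/-- The minimum over the concentration parameter of the cross entropy of the Laplace-like
distributions around `l'`, relative to the one with parameters `l` and `ρ`. -/
noncomputable def crossEntropy (l : AString A) (ρ : ℝ) (l' : AString A) : ℝ :=
  geomEntropy (meanDist l ρ l') + ∫ s, logSphere l' s ∂laplaceLike l ρ

/-- The distribution charges every string. -/
lemma eq_zero_of_ae_eq_zero (hρ : 0 < ρ) {f : AString A → ℝ}
    (hf : f =ᵐ[laplaceLike l ρ] 0) (s : AString A) : f s = 0 := by
  by_contra hs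
  have h0 : laplaceLike l ρ {t | f t ≠ 0} = 0 := ae_iff.1 hf
  rw [laplaceLike_apply, ENNReal.tsum_eq_zero] at h0
  have := h0 ⟨s, hs⟩
  rw [ENNReal.ofReal_eq_zero] at this
  exact absurd (laplaceProb_pos l s hρ) (not_lt.2 this)

lemma meanDist_pos (hρ : 0 < ρ) (l' : AString A) : 0 < meanDist l ρ l' := by
  refine lt_of_le_of_ne (integral_nonneg fun s => Nat.cast_nonneg _) fun h => ?_
  have hz := eq_zero_of_ae_eq_zero hρ ((integral_eq_zero_iff_of_nonneg
    (fun s => Nat.cast_nonneg _) (integrable_extHamming l l' hρ)).1 h.symm)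
  have heq : ∀ s, s = l' := fun s => extHamming_eq_zero.1 (by exact_mod_cast hz s)
  obtain ⟨s, hs⟩ := nonempty_letter_eq (A := A) 0 none
  obtain ⟨a, -⟩ := exists_pair_ne A
  obtain ⟨t, ht⟩ := nonempty_letter_eq (A := A) 0 (some a)
  have hs : s.letter 0 = none := hs
  have ht : t.letter 0 = some a := ht
  rw [heq s] at hs
  rw [heq t, hs] at ht
  simp at ht

lemma integrable_log_laplaceProb (hρ : 0 < ρ) (l' : AString A) {ρ' : ℝ} (hρ' : 0 < ρ') :
    Integrable (fun s => Real.log (laplaceProb l' ρ' s)) (laplaceLike l ρ) := by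
  have := isProbabilityMeasure_laplaceLike l hρ
  simp_rw [log_laplaceProb _ _ hρ']
  exact (((integrable_extHamming l l' hρ).mul_const _).sub
    (((integrable_extHamming l l' hρ).add (integrable_const 1)).mul_const _)).sub
    (integrable_logSphere l l' hρ)

lemma integral_log_laplaceProb (hρ : 0 < ρ) (l' : AString A) {ρ' : ℝ} (hρ' : 0 < ρ') :
    ∫ s, Real.log (laplaceProb l' ρ' s) ∂laplaceLike l ρ =
      meanDist l ρ l' * Real.log ρ' - (meanDist l ρ l' + 1) * Real.log (ρ' + 1) -
        ∫ s, logSphere l' s ∂laplaceLike l ρ := by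
  have := isProbabilityMeasure_laplaceLike l hρ
  have hd := integrable_extHamming l l' hρ
  have hd1 : Integrable (fun s => (extHamming s l' : ℝ) + 1) (laplaceLike l ρ) :=
    hd.add (integrable_const 1)
  have hd2 : Integrable (fun s => extHamming s l' * Real.log ρ' -
      (extHamming s l' + 1) * Real.log (ρ' + 1)) (laplaceLike l ρ) :=
    (hd.mul_const _).sub (hd1.mul_const _)
  simp_rw [log_laplaceProb _ _ hρ']
  rw [integral_sub hd2 (integrable_logSphere l l' hρ),
    integral_sub (hd.mul_const _) (hd1.mul_const _), integral_mul_const, integral_mul_const,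
    integral_add hd (integrable_const 1)]
  simp [meanDist]

lemma lintegral_laplaceProb_div (hρ : 0 < ρ) (l' : AString A) {ρ' : ℝ} (hρ' : 0 < ρ') :
    ∫⁻ s, ENNReal.ofReal (laplaceProb l' ρ' s / laplaceProb l ρ s) ∂laplaceLike l ρ = 1 := by
  rw [lintegral_laplaceLike, ← tsum_laplaceProb l' hρ']
  refine tsum_congr fun s => ?_
  have := laplaceProb_pos l s hρ
  rw [← ENNReal.ofReal_mul this.le, mul_div_cancel₀ _ this.ne']

/-- Each distribution has its centre as its only mode. -/
lemma exists_laplaceProb_ne (hρ : 0 < ρ) {l' : AString A} {ρ' : ℝ} (hρ' : 0 < ρ') (hl : l' ≠ l) :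
    ∃ s, laplaceProb l' ρ' s ≠ laplaceProb l ρ s := by
  by_contra! h
  have h1 : 0 < extHamming l' l := Nat.pos_of_ne_zero fun h => hl (extHamming_eq_zero.1 h)
  have h2 : laplaceProb l ρ l' < laplaceProb l ρ l :=
    laplaceProb_lt hρ (by rwa [extHamming_self])
  have h3 : laplaceProb l' ρ' l < laplaceProb l' ρ' l' :=
    laplaceProb_lt hρ' (by rwa [extHamming_self, extHamming_comm])
  rw [h, h] at h3
  exact lt_asymm h2 h3

/-- Gibbs' inequality. -/
lemma integral_log_laplaceProb_lt (hρ : 0 < ρ) {l' : AString A} {ρ' : ℝ} (hρ' : 0 < ρ')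
    (hl : l' ≠ l) :
    ∫ s, Real.log (laplaceProb l' ρ' s) ∂laplaceLike l ρ <
      ∫ s, Real.log (laplaceProb l ρ s) ∂laplaceLike l ρ := by
  have := isProbabilityMeasure_laplaceLike l hρ
  set r : AString A → ℝ := fun s => laplaceProb l' ρ' s / laplaceProb l ρ s with hr
  have hrpos : ∀ s, 0 < r s := fun s => div_pos (laplaceProb_pos _ _ hρ') (laplaceProb_pos _ _ hρ)
  have hrint : Integrable r (laplaceLike l ρ) := by
    refine ⟨measurable_from_top.aestronglyMeasurable, ?_⟩
    rw [hasFiniteIntegral_iff_ofReal (Filter.Eventually.of_forall fun s => (hrpos s).le),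
      lintegral_laplaceProb_div hρ l' hρ']
    exact ENNReal.one_lt_top
  have hr1 : ∫ s, r s ∂laplaceLike l ρ = 1 := by
    rw [integral_eq_lintegral_of_nonneg_ae (Filter.Eventually.of_forall fun s => (hrpos s).le)
      hrint.1, lintegral_laplaceProb_div hρ l' hρ', ENNReal.toReal_one]
  have hlog : ∀ s, Real.log (r s) =
      Real.log (laplaceProb l' ρ' s) - Real.log (laplaceProb l ρ s) := fun s =>
    Real.log_div (laplaceProb_pos _ _ hρ').ne' (laplaceProb_pos _ _ hρ).ne'
  have hi' := integrable_log_laplaceProb (l := l) hρ l' hρ'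
  have hi := integrable_log_laplaceProb (l := l) hρ l hρ
  -- Since `r` has integral one, the nonnegative function `r - 1 - log r` integrates to the relative
  -- entropy.
  set f : AString A → ℝ := fun s => r s - 1 -
    (Real.log (laplaceProb l' ρ' s) - Real.log (laplaceProb l ρ s)) with hf
  have hf0 : 0 ≤ f := fun s => by
    have := Real.log_le_sub_one_of_pos (hrpos s)
    rw [hlog] at this
    exact sub_nonneg.2 this
  have hri : Integrable (fun s => r s - 1) (laplaceLike l ρ) := hrint.sub (integrable_const 1)
  have hii : Integrable (fun s => Real.log (laplaceProb l' ρ' s) -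
      Real.log (laplaceProb l ρ s)) (laplaceLike l ρ) := hi'.sub hi
  have hfint : Integrable f (laplaceLike l ρ) :=
    hri.sub hii
  have hval : ∫ s, f s ∂laplaceLike l ρ = ∫ s, Real.log (laplaceProb l ρ s) ∂laplaceLike l ρ -
      ∫ s, Real.log (laplaceProb l' ρ' s) ∂laplaceLike l ρ := by
    rw [hf, integral_sub hri hii,
      integral_sub hrint (integrable_const 1), integral_sub hi' hi, hr1]
    simp
  have hne : ∫ s, f s ∂laplaceLike l ρ ≠ 0 := by
    intro h
    obtain ⟨s, hs⟩ := exists_laplaceProb_ne hρ hρ' hl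
    have h0 := eq_zero_of_ae_eq_zero hρ ((integral_eq_zero_iff_of_nonneg hf0 hfint).1 h) s
    have h1 : r s ≠ 1 := by
      rw [hr, Ne, div_eq_one_iff_eq (laplaceProb_pos _ _ hρ).ne']
      exact hs
    have h2 := Real.log_lt_sub_one_of_pos (hrpos s) h1
    rw [hlog] at h2
    simp only [hf] at h0
    linarith
  have := lt_of_le_of_ne (integral_nonneg hf0) hne.symm
  linarith

/-- Gibbs' inequality is applied at the best parameter for `l'`. For `l` the bound at `ρ` is enough,
so `meanDist l ρ l = ρ` is never needed. -/
lemma crossEntropy_lt (hρ : 0 < ρ) {l' : AString A} (hl : l' ≠ l) :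
    crossEntropy l ρ l < crossEntropy l ρ l' := by
  have hpos := meanDist_pos (l := l) hρ l'
  have h := integral_log_laplaceProb_lt hρ hpos hl
  rw [integral_log_laplaceProb hρ l' hpos, integral_log_laplaceProb hρ l hρ] at h
  have h1 := mul_log_sub_le_neg_geomEntropy (meanDist_pos (l := l) hρ l).le hρ
  unfold crossEntropy
  unfold geomEntropy at h1 ⊢
  linarith

lemma eventually_crossEntropy_lt (hρ : 0 < ρ) {x : ℕ → AString A} {d g : ℕ → AString A → ℝ}
    (hd : ∀ n l', d n l' = (∑ i ∈ Finset.range n, (extHamming (x i) l' : ℝ)) / n)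
    (hg : ∀ n l', 0 ≤ g n l')
    (hdlim : ∀ l', Filter.Tendsto (fun n => d n l') Filter.atTop (nhds (meanDist l ρ l')))
    (hglim : ∀ l', Filter.Tendsto (fun n => g n l') Filter.atTop
      (nhds (∫ s, logSphere l' s ∂laplaceLike l ρ))) :
    ∀ᶠ n in Filter.atTop, ∀ l', l' ≠ l →
      geomEntropy (d n l) + g n l < geomEntropy (d n l') + g n l' := by
  have hlim : ∀ l', Filter.Tendsto (fun n => geomEntropy (d n l') + g n l') Filter.atTop
      (nhds (crossEntropy l ρ l')) := fun l' =>
    ((continuous_geomEntropy.tendsto _).comp (hdlim l')).add (hglim l')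
  -- Outside this radius, once the mean distance from `l` is below its limit plus one, `d n l' + 1`
  -- exceeds the exponential, so `log (d n l' + 1)` alone beats the value at `l`.
  obtain ⟨R, hR⟩ := exists_nat_gt (meanDist l ρ l + Real.exp (crossEntropy l ρ l + 1))
  have hnear : ∀ᶠ n in Filter.atTop, ∀ l' ∈ {t | extHamming l t ≤ R}, l' ≠ l →
      geomEntropy (d n l) + g n l < geomEntropy (d n l') + g n l' := by
    rw [Filter.eventually_all_finite (finite_ball l R)]
    intro l' _
    by_cases hl : l' = l
    · exact Filter.Eventually.of_forall fun _ h => absurd hl h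
    · exact ((hlim l).eventually_lt (hlim l') (crossEntropy_lt hρ hl)).mono fun _ h _ => h
  have h1 := (hdlim l).eventually (gt_mem_nhds (lt_add_one (meanDist l ρ l)))
  have h2 := (hlim l).eventually (gt_mem_nhds (lt_add_one (crossEntropy l ρ l)))
  filter_upwards [hnear, h1, h2, Filter.eventually_gt_atTop 0] with n hnear h1 h2 hn l' hl
  by_cases hR' : extHamming l l' ≤ R
  · exact hnear l' hR' hl
  have hR' : (R : ℝ) ≤ extHamming l l' := by exact_mod_cast (not_le.1 hR').le
  have hn' : (0 : ℝ) < n := by positivity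
  have hsum : (extHamming l l' : ℝ) ≤ d n l + d n l' := by
    rw [hd, hd, ← add_div, ← Finset.sum_add_distrib, le_div_iff₀ hn']
    have : ∑ i ∈ Finset.range n, (extHamming l l' : ℝ) ≤
        ∑ i ∈ Finset.range n, ((extHamming (x i) l : ℝ) + extHamming (x i) l') := by
      refine Finset.sum_le_sum fun i _ => ?_
      have := extHamming_triangle l (x i) l'
      rw [extHamming_comm l (x i)] at this
      exact_mod_cast this
    simpa [mul_comm] using this
  have hexp : Real.exp (crossEntropy l ρ l + 1) ≤ d n l' + 1 := by linarith
  have hd0 : 0 ≤ d n l' := by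
    rw [hd]
    positivity
  have hlog := (Real.le_log_iff_exp_le (by linarith)).2 hexp
  have := log_add_one_le_geomEntropy hd0
  linarith [hg n l']

end Limit

end AString

/-! ### Assembly of the almost sure limits. -/

theorem mainTheorem1 {A : Type*} [Finite A] [Nontrivial A]
    {Ω : Type*} [MeasurableSpace Ω] (P : Measure Ω) [IsProbabilityMeasure P]
    (l : AString A) (ρ : ℝ) (hρ : 0 < ρ)
    (σ : ℕ → Ω → AString A) (hmeas : ∀ i, Measurable (σ i))
    (hindep : iIndepFun σ P)
    (hlaw : ∀ i, P.map (σ i) = AString.laplaceLike l ρ) :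
    ∃ ε₀ : ℝ, 0 < ε₀ ∧ ∀ᵐ ω ∂P, ∀ ε : ℝ, 0 < ε → ε ≤ ε₀ →
      ∃ N₀ : ℕ, 0 < N₀ ∧ ∀ n : ℕ, N₀ ≤ n →
        ∀ (s : Fin n → AString A), (∀ i, s i = σ i ω) →
        ∀ (η : ℕ → Option A) (hη : AString.IsConsensusChoice s η),
        ∀ (l' : AString A) (ρ' : ℝ), AString.IsMLE s l' ρ' ↔
          l' = AString.truncatedConsensus s ε η hη ∧
          ρ' = (1 / n : ℝ) * ∑ i, (AString.extHamming (s i)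
            (AString.truncatedConsensus s ε η hη) : ℝ) := by
  obtain ⟨ε₀, hε₀, hgap⟩ := AString.exists_siteProb_gap l hρ
  refine ⟨ε₀, hε₀, ?_⟩
  have := AString.isProbabilityMeasure_laplaceLike l hρ
  -- Countability gives one null set for all `l'`; it does not depend on `ε` either.
  have : Countable (AString A) := AString.countable_of_nonempty A l
  have hfreq : ∀ᵐ ω ∂P, ∀ j y, Filter.Tendsto (fun n : ℕ => (∑ i ∈ Finset.range n,
      {t : AString A | t.letter j = y}.indicator (1 : AString A → ℝ) (σ i ω)) / n) Filter.atTop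
      (nhds (AString.siteProb l ρ j y)) := by
    rw [ae_all_iff]
    intro j
    rw [ae_all_iff]
    intro y
    have h := AString.ae_tendsto_average hmeas hindep hlaw
      (g := {t : AString A | t.letter j = y}.indicator 1)
      ((integrable_const (1 : ℝ)).indicator MeasurableSpace.measurableSet_top)
    rwa [integral_indicator_one MeasurableSpace.measurableSet_top] at h
  have hdist : ∀ᵐ ω ∂P, ∀ l' : AString A, Filter.Tendsto (fun n : ℕ =>
      (∑ i ∈ Finset.range n, (AString.extHamming (σ i ω) l' : ℝ)) / n) Filter.atTop
      (nhds (AString.meanDist l ρ l')) :=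
    ae_all_iff.2 fun l' =>
      AString.ae_tendsto_average hmeas hindep hlaw (AString.integrable_extHamming l l' hρ)
  have hsphere : ∀ᵐ ω ∂P, ∀ l' : AString A, Filter.Tendsto (fun n : ℕ =>
      (∑ i ∈ Finset.range n, AString.logSphere l' (σ i ω)) / n) Filter.atTop
      (nhds (∫ s, AString.logSphere l' s ∂AString.laplaceLike l ρ)) :=
    ae_all_iff.2 fun l' =>
      AString.ae_tendsto_average hmeas hindep hlaw (AString.integrable_logSphere l l' hρ)
  filter_upwards [hfreq, hdist, hsphere] with ω hfreq hdist hsphere ε hε hεle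
  have h1 := AString.eventually_truncatedConsensus_eq hρ hε
    (fun j hj x hx => hεle.trans_lt (hgap j hj x hx)) hfreq
  have h2 := AString.eventually_crossEntropy_lt hρ (x := fun i => σ i ω) (fun n l' => rfl)
    (fun n l' => div_nonneg (Finset.sum_nonneg fun i _ => AString.logSphere_nonneg _ _)
      (Nat.cast_nonneg n)) hdist hsphere
  -- The estimated concentration must lie in the open half-line, so samples constantly equal to `l`
  -- are excluded.
  have h3 := (hdist l).eventually (lt_mem_nhds (AString.meanDist_pos (l := l) hρ l))
  obtain ⟨N, hN⟩ := Filter.eventually_atTop.1 (h1.and (h2.and h3))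
  refine ⟨N + 1, N.succ_pos, fun n hn s hs η hη l' ρ' => ?_⟩
  obtain ⟨h1, h2, h3⟩ := hN n (by omega)
  rw [h1 s hs η hη, one_div_mul_eq_div]
  have hsum : ∀ f : AString A → ℝ, ∑ i ∈ Finset.range n, f (σ i ω) = ∑ i, f (s i) := fun f => by
    rw [Finset.sum_range]
    exact Finset.sum_congr rfl fun i _ => by rw [hs i]
  refine AString.isMLE_iff s (by omega)
    (d := fun l => (∑ i, (AString.extHamming (s i) l : ℝ)) / n)
    (g := fun l => (∑ i, AString.logSphere l (s i)) / n)
    (fun l => rfl) (fun l => rfl) ?_ (fun l' hl => ?_) l' ρ'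
  · rwa [hsum fun t => (AString.extHamming t l : ℝ)] at h3
  · have h := h2 l' hl
    rwa [hsum fun t => (AString.extHamming t l : ℝ),
      hsum fun t => (AString.extHamming t l' : ℝ), hsum, hsum] at h
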